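/- Let $\Gamma$ be a connected finite simple graph with $n$ vertices, and let $v$ be a vertex of $\Gamma$. Let $\Gamma_v$ be the reduced graph, obtained from $\Gamma$ by removing $v$ together with all edges incident to $v$, and let $W_v = (\mathbb{C}^2)^{\otimes (n-1)}$ be the reduced Hilbert space, with one qubit for each vertex $w \neq v$. For such $w$ let $X_w$ and $Z_w$ denote the operators on $W_v$ that act as the Pauli matrices $\begin{pmatrix}0&1\\1&0\end{pmatrix}$ and $\begin{pmatrix}1&0\\0&-1\end{pmatrix}$, respectively, on the qubit $w$ and as the identity on all other qubits. The free reduced dynamical Lie algebra $\mathfrak{g}^v_{\Gamma,\mathrm{free}}$ is the real Lie algebra of operators on $W_v$ generated, under the commutator bracket, by $$\{\, iX_w : w \neq v \,\},\qquad \{\, iZ_wZ_{w'} : ww' \text{ an edge of } \Gamma_v \,\},\qquad \{\, iZ_w : vw \text{ an edge of } \Gamma \,\}.$$ **Theorem.** Suppose that $\Gamma_v$ is connected and is neither bipartite nor a cycle. Then $\mathfrak{g}^v_{\Gamma,\mathrm{free}}$ is a simple real Lie algebra, and it coincides with the Lie algebra $\mathfrak{su}(W_v)$ of all traceless skew-Hermitian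 operators on $W_v$: $$\mathfrak{g}^v_{\Gamma,\mathrm{free}} = \mathfrak{su}(W_v) \cong \mathfrak{su}(2^{\,n-1}).$$ -/

import Mathlib

open scoped Matrix

/- The commutator bracket `⁅A, B⁆ = A * B - B * A` on an associative ring. -/
attribute [local instance 100] LieRing.ofAssociativeRing

noncomputable section

namespace QAOA

/-! ### Special unitary Lie algebras -/

/-- `su(W)` for a finite-dimensional complex inner product space `W`: the real Lie algebra of
traceless skew-Hermitian operators on `W`. -/
def specialUnitary (W : Type*) [NormedAddCommGroup W] [InnerProductSpace ℂ W]
    [FiniteDimensional ℂ W] : LieSubalgebra ℝ (Module.End ℂ W) where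
  carrier := {A | LinearMap.adjoint A = -A ∧ LinearMap.trace ℂ W A = 0}
  add_mem' := by
    rintro A B ⟨hA, hA'⟩ ⟨hB, hB'⟩
    refine ⟨?_, ?_⟩
    · rw [map_add, hA, hB]; abel
    · rw [map_add, hA', hB', add_zero]
  zero_mem' := by
    refine ⟨?_, ?_⟩ <;> simp
  smul_mem' := by
    rintro c A ⟨hA, hA'⟩
    have h : c • A = (c : ℂ) • A := by
      ext x
      simp
    refine ⟨?_, ?_⟩
    · rw [h, map_smulₛₗ, hA]; simp
    · rw [h, map_smul, hA', smul_zero]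
  lie_mem' := by
    rintro A B ⟨hA, -⟩ ⟨hB, -⟩
    refine ⟨?_, ?_⟩
    · simp only [LieRing.of_associative_ring_bracket, Module.End.mul_eq_comp, map_sub,
        LinearMap.adjoint_comp] at *
      rw [hA, hB]
      ext x
      simp
    · rw [LieRing.of_associative_ring_bracket, map_sub, LinearMap.trace_mul_comm, sub_self]

/-- `su(N)`: the real Lie algebra of traceless skew-Hermitian complex `N × N` matrices. -/
def su (N : ℕ) : LieSubalgebra ℝ (Matrix (Fin N) (Fin N) ℂ) where
  carrier := {A | Aᴴ = -A ∧ A.trace = 0}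
  add_mem' := by
    rintro A B ⟨hA, hA'⟩ ⟨hB, hB'⟩
    refine ⟨?_, ?_⟩
    · rw [Matrix.conjTranspose_add, hA, hB]; abel
    · rw [Matrix.trace_add, hA', hB', add_zero]
  zero_mem' := by
    refine ⟨?_, ?_⟩ <;> simp
  smul_mem' := by
    rintro c A ⟨hA, hA'⟩
    refine ⟨?_, ?_⟩
    · rw [Matrix.conjTranspose_smul, hA]; simp
    · rw [Matrix.trace_smul, hA', smul_zero]
  lie_mem' := by
    rintro A B ⟨hA, -⟩ ⟨hB, -⟩
    refine ⟨?_, ?_⟩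
    · rw [LieRing.of_associative_ring_bracket, Matrix.conjTranspose_sub,
        Matrix.conjTranspose_mul, Matrix.conjTranspose_mul, hA, hB]
      simp
    · rw [LieRing.of_associative_ring_bracket, Matrix.trace_sub, Matrix.trace_mul_comm, sub_self]

/-! ### Qubits and Pauli operators -/

/-- The Hilbert space `(ℂ²)^{⊗ Q}` of a finite set `Q` of qubits, written in its orthonormal
computational basis, which is indexed by the bit strings `Q → Fin 2`. -/
abbrev StateSpace (Q : Type*) [Fintype Q] : Type _ := EuclideanSpace ℂ (Q → Fin 2)

section Pauli

variable {Q : Type*} [Fintype Q] [DecidableEq Q]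

/-- The tensor (Kronecker) product `⨂_q A_q` of `2 × 2` matrices, in the computational basis. -/
def tensorMatrix (A : Q → Matrix (Fin 2) (Fin 2) ℂ) : Matrix (Q → Fin 2) (Q → Fin 2) ℂ :=
  Matrix.of fun x y => ∏ q, A q (x q) (y q)

/-- The operator that acts as `A` on the qubit `q` and as the identity on all other qubits. -/
def onQubit (q : Q) (A : Matrix (Fin 2) (Fin 2) ℂ) : Module.End ℂ (StateSpace Q) :=
  Matrix.toEuclideanLin (tensorMatrix (Function.update (fun _ => 1) q A))

/-- The Pauli operator `X_q`. -/
def pauliX (q : Q) : Module.End ℂ (StateSpace Q) := onQubit q !![0, 1; 1, 0]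

/-- The Pauli operator `Z_q`. -/
def pauliZ (q : Q) : Module.End ℂ (StateSpace Q) := onQubit q !![1, 0; 0, -1]

end Pauli

/-! ### Graphs and the free reduced dynamical Lie algebra -/

/-- A graph is a cycle if it is isomorphic to the cycle graph `C_m` for some `m ≥ 3`. -/
def IsCycleGraph {V : Type*} (G : SimpleGraph V) : Prop :=
  ∃ m : ℕ, 3 ≤ m ∧ Nonempty (G ≃g SimpleGraph.cycleGraph m)

section Reduced

variable {V : Type*} (Γ : SimpleGraph V) (v : V)

/-- The reduced graph `Γ_v`: remove the vertex `v` together with all edges incident to it. -/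
def reducedGraph : SimpleGraph {w : V // w ≠ v} :=
  Γ.comap (fun w => (w : V))

variable [Fintype V] [DecidableEq V]

/-- The reduced Hilbert space `W_v`: one qubit for each vertex other than `v`. -/
abbrev ReducedSpace : Type _ := StateSpace {w : V // w ≠ v}

/-- The free reduced dynamical Lie algebra of `(Γ, v)`: the real Lie algebra generated by all
`i X_w` with `w ≠ v`, all `i Z_w Z_{w'}` with `w w'` an edge of `Γ_v`, and all `i Z_w` with `w` a
neighbour of `v` in `Γ`. -/
def freeReducedDLA : LieSubalgebra ℝ (Module.End ℂ (ReducedSpace v)) :=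
  LieSubalgebra.lieSpan ℝ (Module.End ℂ (ReducedSpace v))
    ({A | ∃ w, A = Complex.I • pauliX w} ∪
      {A | ∃ w w', (reducedGraph Γ v).Adj w w' ∧ A = Complex.I • (pauliZ w * pauliZ w')} ∪
      {A | ∃ w : {w : V // w ≠ v}, Γ.Adj v w ∧ A = Complex.I • pauliZ w})

end Reduced

end QAOA

end

namespace QAOA

/-! ### Pauli strings -/

/-! Two products of Pauli matrices commute or anticommute, and if they anticommute their bracket is
twice their product. Modulo phases these products form a vector space over `ZMod 2` with symplectic
form `sform`, so a Lie algebra of operators yields a set of strings closed under adding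
anticommuting members (`stringClosed_stringSupport`). It remains to generate every nonzero string
from all X_a, the Z_a Z_b on edges, and one Z_u, where u is a neighbour of v.

A connected graph that is neither bipartite nor a cycle has a vertex with three neighbours
(`exists_claw`). Around such a vertex, brackets create new pairs Z_c Z_y
(`StringClosed.claw_extend`). The graph of all available pairs is stable under this rule and still
not bipartite, so it contains a triangle and is therefore complete (`ClawClosed.exists_triangle`,
`ClawClosed.adj_of_ne`). Triangles carry Z_u to every vertex, and one-qubit letters together with
all Z_a Z_b give every nonzero string (`StringClosed.mem_of_ne_zero`).

The nonzero strings, with suitable phases, span su over ℝ, which gives equality. For simplicity, the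
square of ad P is, up to a scalar, the projection onto the strings anticommuting with P. Such
projections isolate a single string from any nonzero element of an ideal, and brackets then reach
all the others. -/

/-- A Pauli string up to phase: at each qubit, `(x, z)` stands for `X ^ x * Z ^ z`. -/
abbrev PauliString (Q : Type*) : Type _ := Q → ZMod 2 × ZMod 2

section SymplecticForm

variable {Q : Type*} [Fintype Q]

/-- The symplectic form on Pauli strings; it is `1` exactly when the operators anticommute. -/
def sform (s t : PauliString Q) : ZMod 2 :=
  ∑ q, ((s q).1 * (t q).2 + (s q).2 * (t q).1)

@[simp]
lemma sform_add_left (s s' t : PauliString Q) : sform (s + s') t = sform s t + sform s' t := by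
  simp only [sform, ← Finset.sum_add_distrib]
  exact Finset.sum_congr rfl fun q _ => by simp; ring

lemma sform_comm (s t : PauliString Q) : sform s t = sform t s :=
  Finset.sum_congr rfl fun q _ => by ring

@[simp]
lemma sform_add_right (s t t' : PauliString Q) : sform s (t + t') = sform s t + sform s t' := by
  rw [sform_comm, sform_add_left, sform_comm t, sform_comm t']

@[simp]
lemma sform_self (s : PauliString Q) : sform s s = 0 :=
  Finset.sum_eq_zero fun q _ => by rw [mul_comm (s q).2]; exact CharTwo.add_self_eq_zero _

/-- A set of strings is closed if it contains the sum of any two of its anticommuting members. -/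
def StringClosed (S : Set (PauliString Q)) : Prop :=
  ∀ ⦃s⦄, s ∈ S → ∀ ⦃t⦄, t ∈ S → sform s t = 1 → s + t ∈ S

/-- The redundant scalar makes `match_scalars` compare coefficients in `ZMod 2`, so that letters
occurring twice cancel. -/
lemma StringClosed.step {S : Set (PauliString Q)} (hS : StringClosed S) {s t r : PauliString Q}
    (hs : s ∈ S) (ht : t ∈ S) (hf : sform s t = 1) (h : (1 : ZMod 2) • s + t = r) : r ∈ S := by
  rw [← h, one_smul]; exact hS hs ht hf

end SymplecticForm

section Strings

variable {Q : Type*} [Fintype Q] [DecidableEq Q]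

/-- The string with a single `X`. -/
def xs (a : Q) : PauliString Q := Pi.single a (1, 0)

/-- The string with a single `Z`. -/
def zs (a : Q) : PauliString Q := Pi.single a (0, 1)

lemma sform_single_left (a : Q) (p : ZMod 2 × ZMod 2) (t : PauliString Q) :
    sform (Pi.single a p) t = p.1 * (t a).2 + p.2 * (t a).1 := by
  rw [sform, Finset.sum_eq_single a]
  · simp
  · intro b _ hb; simp [hb]
  · simp

lemma sform_single_right (a : Q) (p : ZMod 2 × ZMod 2) (t : PauliString Q) :
    sform t (Pi.single a p) = p.1 * (t a).2 + p.2 * (t a).1 := by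
  rw [sform_comm, sform_single_left]

@[simp]
lemma sform_xs_xs (a b : Q) : sform (xs a) (xs b) = 0 := by
  rcases eq_or_ne a b with rfl | h <;> simp [xs, sform_single_left, *]

@[simp]
lemma sform_zs_zs (a b : Q) : sform (zs a) (zs b) = 0 := by
  rcases eq_or_ne a b with rfl | h <;> simp [zs, sform_single_left, *]

@[simp]
lemma sform_xs_zs (a b : Q) : sform (xs a) (zs b) = if a = b then 1 else 0 := by
  rcases eq_or_ne a b with rfl | h <;> simp [xs, zs, sform_single_left, *]

@[simp]
lemma sform_zs_xs (a b : Q) : sform (zs a) (xs b) = if b = a then 1 else 0 := by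
  rw [sform_comm, sform_xs_zs]

/-- Nondegeneracy of the form, tested on one qubit where the string is nontrivial. -/
lemma exists_sform_eq_one {s : PauliString Q} (hs : s ≠ 0) : ∃ t, sform s t = 1 := by
  obtain ⟨q, hq⟩ := Function.ne_iff.1 hs
  have key : ∀ p : ZMod 2 × ZMod 2, p ≠ 0 → ∃ r : ZMod 2 × ZMod 2, r.1 * p.2 + r.2 * p.1 = 1 := by
    decide
  obtain ⟨r, hr⟩ := key _ hq
  exact ⟨Pi.single q r, by rw [sform_single_right, hr]⟩

/-- Two nonzero strings have a common anticommuting string. -/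
lemma exists_sform_eq_one_and {s t : PauliString Q} (hs : s ≠ 0) (ht : t ≠ 0) :
    ∃ r, sform s r = 1 ∧ sform t r = 1 := by
  have key : ∀ c : ZMod 2, c = 0 ∨ c = 1 := by decide
  obtain ⟨p, hp⟩ := exists_sform_eq_one hs
  obtain ⟨r, hr⟩ := exists_sform_eq_one ht
  rcases key (sform t p) with h | h
  · rcases key (sform s r) with h' | h'
    -- Here p anticommutes only with s and r only with t, so the sum anticommutes with both.
    · exact ⟨p + r, by simp [*], by simp [*]⟩
    · exact ⟨r, h', hr⟩
  · exact ⟨p, hp, h⟩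

/-! ### Generating strings by brackets -/

namespace StringClosed

variable {S : Set (PauliString Q)}

/-- Bracketing X_x with two edges at x: the two factors Z_x cancel. -/
lemma xs_add_zs_add_zs (hS : StringClosed S) (hX : ∀ a, xs a ∈ S) {x a y : Q}
    (hax : a ≠ x) (hyx : y ≠ x) (ha : zs x + zs a ∈ S) (hy : zs x + zs y ∈ S) :
    xs x + zs y + zs a ∈ S := by
  refine hS.step (hS (hX x) hy ?_) ha ?_ (by match_scalars <;> rfl) <;>
  simp [hax.symm, hyx.symm]

/-- A claw with centre `x` and leaves `a`, `b`, `y`. -/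
lemma claw (hS : StringClosed S) (hX : ∀ a, xs a ∈ S) {x a b y : Q}
    (hab : a ≠ b) (hay : a ≠ y) (hax : a ≠ x) (hbx : b ≠ x) (hyx : y ≠ x)
    (ha : zs x + zs a ∈ S) (hb : zs x + zs b ∈ S) (hy : zs x + zs y ∈ S) :
    xs a + zs y + zs b ∈ S := by
  have h1 := hS.xs_add_zs_add_zs hX hax hyx ha hy
  have h2 := hS.xs_add_zs_add_zs hX hax hbx ha hb
  -- The extra X_a makes this anticommute with `h2`, at a alone; adding `h2` then cancels X_x and
  -- Z_a.
  have h3 : xs x + zs y + zs a + xs a ∈ S := hS h1 (hX a) (by simp [hay])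
  refine hS.step h3 h2 ?_ (by match_scalars <;> rfl)
  simp [hab, hax.symm, hbx.symm, hyx.symm]

/-- A neighbour `c` of a leaf `a` of a claw is joined to any other leaf `y`. -/
lemma claw_extend (hS : StringClosed S) (hX : ∀ a, xs a ∈ S) {x a b y c : Q}
    (hab : a ≠ b) (hay : a ≠ y) (hby : b ≠ y) (hax : a ≠ x) (hbx : b ≠ x) (hyx : y ≠ x)
    (hca : c ≠ a) (hcy : c ≠ y)
    (ha : zs x + zs a ∈ S) (hb : zs x + zs b ∈ S) (hy : zs x + zs y ∈ S)
    (hc : zs a + zs c ∈ S) : zs c + zs y ∈ S := by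
  have e := hS.claw hX hab hay hax hbx hyx ha hb hy
  have e1 := hS e hc (by simp [hca.symm])
  have e2 : zs a + zs c + zs y + zs b ∈ S :=
    hS.step e1 (hX a) (by simp [hay, hab, hca.symm]) (by match_scalars <;> rfl)
  -- The same claw with y in the role of a gives X_y Z_a Z_b, which removes Z_a Z_b.
  have e3 : zs c + zs y + xs y ∈ S :=
    hS.step e2 (hS.claw hX hby.symm hay.symm hyx hbx hax hy hb ha)
      (by simp [hay.symm, hby.symm, hcy.symm]) (by match_scalars <;> rfl)
  exact hS.step e3 (hX y) (by simp [hcy.symm]) (by match_scalars <;> rfl)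

/-- Using Z_u one gets X_u Z_x, which cancels the X_u of X_u Z_y Z_x X_x and leaves Z_y X_x; the
edge from x to y then removes Z_y. -/
lemma zs_mem_of_triangle (hS : StringClosed S) (hX : ∀ a, xs a ∈ S) {u x y : Q}
    (hxu : x ≠ u) (hyu : y ≠ u) (hxy : x ≠ y) (hu : zs u ∈ S)
    (hux : zs u + zs x ∈ S) (huy : zs u + zs y ∈ S) (h : zs x + zs y ∈ S) : zs x ∈ S := by
  have e1 := hS (hX u) huy (by simp [hyu.symm])
  have e2 := hS hux (hX x) (by simp [hxu])
  have e3 : xs u + zs y + zs x + xs x ∈ S :=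
    hS.step e1 e2 (by simp [hxu, hxu.symm, hxy]) (by match_scalars <;> rfl)
  have e4 : xs u + zs x ∈ S :=
    hS.step (hS (hX u) hux (by simp [hxu.symm])) hu (by simp) (by match_scalars <;> rfl)
  have e5 : zs y + xs x ∈ S :=
    hS.step e3 e4 (by simp [hxu.symm, hyu.symm]) (by match_scalars <;> rfl)
  have e6 : zs x + xs x ∈ S :=
    hS.step e5 h (by simp [hxy]) (by match_scalars <;> rfl)
  exact hS.step e6 (hX x) (by simp) (by match_scalars <;> rfl)

lemma single_mem (hS : StringClosed S) (hX : ∀ a, xs a ∈ S) (hZ : ∀ a, zs a ∈ S) (a : Q) :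
    ∀ p : ZMod 2 × ZMod 2, p ≠ 0 → Pi.single a p ∈ S := by
  have h : Pi.single a (1, 1) ∈ S := by
    have := hS (hX a) (hZ a) (by simp)
    rwa [xs, zs, ← Pi.single_add] at this
  have key : ∀ p : ZMod 2 × ZMod 2, p ≠ 0 → p = (1, 0) ∨ p = (0, 1) ∨ p = (1, 1) := by decide
  intro p hp
  rcases key p hp with rfl | rfl | rfl
  exacts [hX a, hZ a, h]

/-- The letter of a member of `S` at a qubit can be changed to any other nontrivial letter. -/
lemma add_single_mem (hS : StringClosed S) (hX : ∀ a, xs a ∈ S) (hZ : ∀ a, zs a ∈ S) {a : Q}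
    {t : PauliString Q} (ht : t a = 0) {p r : ZMod 2 × ZMod 2} (hp : p ≠ 0) (hr : r ≠ 0)
    (h : t + Pi.single a p ∈ S) : t + Pi.single a r ∈ S := by
  rcases eq_or_ne p r with rfl | hpr
  · exact h
  have key1 : ∀ p r : ZMod 2 × ZMod 2, p ≠ r → p + r ≠ 0 := by decide
  have key2 : ∀ p r : ZMod 2 × ZMod 2, p ≠ 0 → r ≠ 0 → p ≠ r →
      (p + r).1 * p.2 + (p + r).2 * p.1 = 1 := by decide
  have key3 : ∀ p r : ZMod 2 × ZMod 2, p + (p + r) = r := by decide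
  -- The letter p + r anticommutes with p and turns it into r.
  have := hS h (hS.single_mem hX hZ a _ (key1 p r hpr))
    (by rw [sform_single_right]; simpa [ht] using key2 p r hp hr hpr)
  rwa [add_assoc, ← Pi.single_add, key3] at this

lemma single_add_single_mem (hS : StringClosed S) (hX : ∀ a, xs a ∈ S) (hZ : ∀ a, zs a ∈ S)
    {a b : Q} (hab : a ≠ b) (h : zs a + zs b ∈ S) {p r : ZMod 2 × ZMod 2} (hp : p ≠ 0)
    (hr : r ≠ 0) : Pi.single a p + Pi.single b r ∈ S := by
  have h1 : zs a + Pi.single b r ∈ S :=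
    hS.add_single_mem hX hZ (by simp [zs, hab.symm]) (by decide) hr h
  rw [add_comm] at h1 ⊢
  exact hS.add_single_mem hX hZ (by simp [hab]) (by decide) hp h1

/-- All one-qubit strings and all `Z_a Z_b` generate all nontrivial strings. -/
lemma mem_of_ne_zero (hS : StringClosed S) (hX : ∀ a, xs a ∈ S) (hZ : ∀ a, zs a ∈ S)
    (hZZ : ∀ a b, a ≠ b → zs a + zs b ∈ S) {s : PauliString Q} (hs : s ≠ 0) : s ∈ S := by
  suffices H : ∀ T : Finset Q, T.Nonempty → ∀ s : PauliString Q, (∀ q, s q ≠ 0 ↔ q ∈ T) → s ∈ S by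
    obtain ⟨q, hq⟩ := Function.ne_iff.1 hs
    exact H (Finset.univ.filter fun q => s q ≠ 0) ⟨q, by simpa using hq⟩ s (by simp)
  intro T hT
  induction hT using Finset.Nonempty.cons_induction with
  | singleton a =>
    intro s hs
    have : s = Pi.single a (s a) := by
      ext1 q
      rcases eq_or_ne q a with rfl | h
      · simp
      · simpa [h] using hs q
    rw [this]
    exact hS.single_mem hX hZ a _ ((hs a).2 (by simp))
  | cons b T hb hT ih =>
    intro s hs
    obtain ⟨a, ha⟩ := hT
    have hab : a ≠ b := fun h => hb (h ▸ ha)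
    have key : ∀ p : ZMod 2 × ZMod 2, p ≠ 0 → ∃ r : ZMod 2 × ZMod 2, r ≠ 0 ∧ p + r ≠ 0 ∧
        r.1 * (p + r).2 + r.2 * (p + r).1 = 1 := by decide
    obtain ⟨r, hr, hpr, hf⟩ := key (s a) ((hs a).2 (by simp [ha]))
    have hsb : s b ≠ 0 := (hs b).2 (by simp)
    -- Adding t erases the letter at b and keeps a nontrivial one at a, so s + t is supported on T.
    -- The choice of r makes s + t anticommute with t, and adding t again recovers s.
    set t : PauliString Q := Pi.single a r + Pi.single b (s b) with ht
    have htS : t ∈ S := hS.single_add_single_mem hX hZ hab (hZZ a b hab) hr hsb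
    have hst : s + t ∈ S := by
      refine ih (s + t) fun q => ?_
      rcases eq_or_ne q a with rfl | hqa
      · simpa [ht, hab, ha] using hpr
      · rcases eq_or_ne q b with rfl | hqb
        · simp [ht, hqa, hb, CharTwo.add_self_eq_zero, Prod.ext_iff]
        · simpa [ht, hqa, hqb] using hs q
    refine hS.step hst htS ?_ (by match_scalars <;> rfl)
    rw [sform_add_left, sform_self, add_zero, ht, sform_add_right, sform_single_right,
      sform_single_right]
    have key2 : ∀ p r : ZMod 2 × ZMod 2, r.1 * (p + r).2 + r.2 * (p + r).1 =
      r.1 * p.2 + r.2 * p.1 + (p.1 * p.2 + p.2 * p.1) := by decide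
    rw [key2] at hf
    have key3 : ∀ p : ZMod 2 × ZMod 2, p.1 * p.2 + p.2 * p.1 = 0 := by decide
    rwa [key3, add_zero] at hf ⊢

end StringClosed

end Strings

/-! ### Graphs with a claw -/

section Graphs

variable {V : Type*} {G : SimpleGraph V}

lemma forall_of_preconnected (hG : G.Preconnected) {P : V → Prop} {x : V} (hx : P x)
    (hP : ∀ v w, G.Adj v w → P v → P w) (y : V) : P y := by
  obtain ⟨p⟩ := hG x y
  induction p with
  | nil => exact hx
  | cons h _ ih => exact ih (hP _ _ h hx)

lemma exists_ne_ne_of_three {p q r : V} (hpq : p ≠ q) (hpr : p ≠ r) (hqr : q ≠ r) (v w : V) :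
    ∃ t, (t = p ∨ t = q ∨ t = r) ∧ t ≠ v ∧ t ≠ w := by
  by_contra! h
  have h1 : p = v ∨ p = w := or_iff_not_imp_left.2 (h p (by simp))
  have h2 : q = v ∨ q = w := or_iff_not_imp_left.2 (h q (by simp))
  have h3 : r = v ∨ r = w := or_iff_not_imp_left.2 (h r (by simp))
  grind

/-- A connected graph which contains a cycle and has no vertex with three neighbours is a cycle. -/
lemma isCycleGraph_of_isCycle (hG : G.Connected)
    (h3 : ∀ x a b y, G.Adj x a → G.Adj x b → G.Adj x y → a ≠ b → y = a ∨ y = b)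
    {u : V} {p : G.Walk u u} (hp : p.IsCycle) : IsCycleGraph G := by
  obtain ⟨k, hk⟩ : ∃ k, p.length = k + 3 := ⟨p.length - 3, by have := hp.three_le_length; omega⟩
  -- Indices are cyclic, so i + 1 wraps around at the last vertex of the cycle.
  let f : Fin (k + 3) → V := fun i => p.getVert i
  have hinj : Function.Injective f := fun i j hij => Fin.ext <|
    hp.getVert_injOn' (show (i : ℕ) ≤ p.length - 1 by omega)
      (show (j : ℕ) ≤ p.length - 1 by omega) hij
  have hadj : ∀ i, G.Adj (f i) (f (i + 1)) := fun i => by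
    have h := p.adj_getVert_succ (i := i) (by omega)
    rcases eq_or_ne i (Fin.last _) with rfl | hi
    · have h0 : p.getVert (k + 2 + 1) = f 0 :=
        (p.getVert_of_length_le (by omega)).trans p.getVert_zero.symm
      rw [Fin.last_add_one, ← h0]
      exact h
    · have : f (i + 1) = p.getVert (i + 1) := by
        simp only [f]; rw [Fin.val_add_one_of_lt (Fin.lt_last_iff_ne_last.2 hi)]
      rwa [this]
  have hnb : ∀ i w, G.Adj (f i) w → w = f (i - 1) ∨ w = f (i + 1) := fun i w hw => by
    have h1 := hadj (i - 1)
    rw [sub_add_cancel] at h1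
    refine h3 (f i) _ _ w h1.symm (hadj i) hw (hinj.ne ?_)
    intro h
    -- If the two cycle neighbours of a vertex coincided, 2 would vanish modulo a length of at least
    -- 3.
    have h2 : (1 + 1 : Fin (k + 3)) = 0 := by
      have := congrArg (· - i + 1) h
      simpa [sub_eq_add_neg, add_comm, add_left_comm] using this.symm
    have h4 := congrArg Fin.val h2
    rw [Fin.val_add, Fin.val_one, Fin.val_zero, Nat.mod_eq_of_lt (by omega)] at h4
    omega
  have hsurj : Function.Surjective f :=
    forall_of_preconnected hG.preconnected (P := fun v => ∃ i, f i = v) ⟨0, rfl⟩ <| by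
      rintro _ w hw ⟨i, rfl⟩
      rcases hnb i w hw with h | h
      exacts [⟨_, h.symm⟩, ⟨_, h.symm⟩]
  let e := Equiv.ofBijective f ⟨hinj, hsurj⟩
  refine ⟨k + 3, by omega, ⟨SimpleGraph.Iso.symm ⟨e, ?_⟩⟩⟩
  intro i j
  change G.Adj (f i) (f j) ↔ _
  rw [SimpleGraph.cycleGraph_adj]
  constructor
  · intro h
    rcases hnb i _ h with h | h
    · left; rw [hinj h]; abel
    · right; rw [hinj h]; abel
  · rintro (h | h)
    · rw [← sub_add_cancel i j, h, add_comm]; exact (hadj j).symm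
    · rw [← sub_add_cancel j i, h, add_comm]; exact hadj i

/-- Acyclic graphs are bipartite, so there is a cycle; with at most two neighbours at each vertex,
connectedness would make it the whole graph. Leaves may be adjacent to each other. -/
lemma exists_claw (hG : G.Connected) (hbip : ¬ G.IsBipartite) (hcyc : ¬ IsCycleGraph G) :
    ∃ x a b y, G.Adj x a ∧ G.Adj x b ∧ G.Adj x y ∧ a ≠ b ∧ a ≠ y ∧ b ≠ y := by
  by_contra! h
  have hac : ¬ G.IsAcyclic := fun hac => hbip hac.isBipartite
  simp only [SimpleGraph.IsAcyclic, not_forall, not_not] at hac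
  obtain ⟨u, p, hp⟩ := hac
  refine hcyc (isCycleGraph_of_isCycle hG (fun x a b y ha hb hy hab => ?_) hp)
  by_contra! hne
  exact hne.2 (h x a b y ha hb hy hab hne.1.symm).symm

/-- In a claw, every neighbour of a leaf is joined to all other leaves. -/
def ClawClosed (G : SimpleGraph V) : Prop :=
  ∀ ⦃x a b y c⦄, G.Adj x a → G.Adj x b → G.Adj x y → a ≠ b → a ≠ y → b ≠ y →
    G.Adj a c → c ≠ y → G.Adj c y

/-- Without triangles, closure forces every neighbour of a neighbour of x to be joined to all
neighbours of x, and every vertex to be adjacent to x or to a. Colouring by adjacency to x is then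
proper, contradicting non-bipartiteness. -/
lemma ClawClosed.exists_triangle (h : ClawClosed G) (hG : G.Connected) (hbip : ¬ G.IsBipartite)
    {x a b y : V} (ha : G.Adj x a) (hb : G.Adj x b) (hy : G.Adj x y) (hab : a ≠ b) (hay : a ≠ y)
    (hby : b ≠ y) : ∃ p q r, G.Adj p q ∧ G.Adj p r ∧ G.Adj q r := by
  classical
  by_contra! hnt
  have third : ∀ v w, ∃ t, G.Adj x t ∧ t ≠ v ∧ t ≠ w := fun v w => by
    obtain ⟨t, rfl | rfl | rfl, h⟩ := exists_ne_ne_of_three hab hay hby v w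
    exacts [⟨_, ha, h⟩, ⟨_, hb, h⟩, ⟨_, hy, h⟩]
  have hA : ∀ v w c, G.Adj x v → G.Adj x w → G.Adj v c → G.Adj c w := fun v w c hv hw hc => by
    rcases eq_or_ne v w with rfl | hvw
    · exact hc.symm
    obtain ⟨t, ht, htv, htw⟩ := third v w
    refine h hv ht hw htv.symm hvw htw hc ?_
    rintro rfl
    exact hnt x v c hv hw hc
  have hB : ∀ c d, G.Adj a c → G.Adj c d → G.Adj x d := fun c d hc hd => by
    rcases eq_or_ne d a with rfl | hda
    · exact ha
    obtain ⟨t, ht, hta, htd⟩ := third a d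
    refine h hc.symm (hA a t c ha ht hc) hd hta.symm hda.symm htd ha.symm ?_
    rintro rfl
    exact hnt x a c ha hd.symm hc
  have hcover : ∀ v, G.Adj x v ∨ G.Adj a v :=
    forall_of_preconnected hG.preconnected (x := x) (Or.inr ha.symm) fun v w hvw hv => by
      rcases hv with hv | hv
      · exact Or.inr (hA v a w hv ha hvw).symm
      · exact Or.inl (hB v w hv hvw)
  refine hbip ⟨SimpleGraph.Coloring.mk (fun v => if G.Adj x v then 0 else 1) ?_⟩
  intro v w hvw
  by_cases hv : G.Adj x v <;> by_cases hw : G.Adj x w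
  · exact absurd hvw (hnt x v w hv hw)
  · simp [hv, hw]
  · simp [hv, hw]
  · exact absurd (hB v w ((hcover v).resolve_left hv) hvw) hw

/-- In the claw at p with leaves q, r, v, the vertex r also serves as the neighbour of the leaf q.
-/
lemma ClawClosed.adj_of_triangle (h : ClawClosed G) {p q r v : V} (hpq : G.Adj p q)
    (hpr : G.Adj p r) (hqr : G.Adj q r) (hv : G.Adj p v) (hvr : v ≠ r) : G.Adj v r := by
  rcases eq_or_ne v q with rfl | hvq
  · exact hqr
  · exact (h hpq hpr hv hqr.ne hvq.symm hvr.symm hqr hvr.symm).symm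

/-- Being joined to the whole triangle propagates along edges. If w is neither p nor q, then p, q, w
is again a triangle, and v, adjacent to p, is joined to w. -/
lemma ClawClosed.adj_of_ne (h : ClawClosed G) (hG : G.Connected) {p q r : V} (hpq : G.Adj p q)
    (hpr : G.Adj p r) (hqr : G.Adj q r) {v w : V} (hvw : v ≠ w) : G.Adj v w := by
  have hall : ∀ v, (v ≠ p → G.Adj v p) ∧ (v ≠ q → G.Adj v q) ∧ (v ≠ r → G.Adj v r) := by
    refine forall_of_preconnected hG.preconnected (x := p)
      ⟨fun h => absurd rfl h, fun _ => hpq, fun _ => hpr⟩ ?_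
    intro v w hvw ⟨h1, h2, h3⟩
    have T1 := @ClawClosed.adj_of_triangle _ _ h
    by_cases hvp : v = p
    · subst hvp
      exact ⟨fun _ => hvw.symm, fun hw => T1 hpr hpq hqr.symm hvw hw,
        fun hw => T1 hpq hpr hqr hvw hw⟩
    by_cases hvq : v = q
    · subst hvq
      exact ⟨fun hw => T1 hqr hpq.symm hpr.symm hvw hw, fun _ => hvw.symm,
        fun hw => T1 hpq.symm hqr hpr hvw hw⟩
    have hp := h1 hvp
    have hq := h2 hvq
    have hwp : w ≠ p → G.Adj w p := fun hw => T1 hq hp hpq.symm hvw hw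
    have hwq : w ≠ q → G.Adj w q := fun hw => T1 hp hq hpq hvw hw
    refine ⟨hwp, hwq, fun hw => ?_⟩
    rcases eq_or_ne w p with rfl | hw'
    · exact hpr
    · exact T1 hpq hpr hqr (hwp hw').symm hw
  obtain ⟨h1, h2, h3⟩ := hall v
  obtain ⟨h1', h2', h3'⟩ := hall w
  by_cases hvp : v = p
  · subst hvp; exact (h1' hvw.symm).symm
  by_cases hwp : w = p
  · subst hwp; exact h1 hvw
  by_cases hwq : w = q
  · subst hwq; exact h2 hvw
  exact h.adj_of_triangle hpq (h1' hwp).symm (h2' hwq).symm (h1 hvp).symm hvw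

end Graphs

/-! ### From the graph to all strings -/

section Strings

variable {Q : Type*} [Fintype Q] [DecidableEq Q] {S : Set (PauliString Q)}

/-- The graph of all pairs `a`, `b` for which `Z_a Z_b` belongs to `S`. -/
def zzGraph (S : Set (PauliString Q)) : SimpleGraph Q where
  Adj a b := a ≠ b ∧ zs a + zs b ∈ S
  symm := ⟨fun a b h => ⟨h.1.symm, by rw [add_comm]; exact h.2⟩⟩
  loopless := ⟨fun _ h => h.1 rfl⟩

lemma StringClosed.clawClosed (hS : StringClosed S) (hX : ∀ a, xs a ∈ S) :
    ClawClosed (zzGraph S) := by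
  rintro x a b y c ⟨hax, ha⟩ ⟨hbx, hb⟩ ⟨hyx, hy⟩ hab hay hby ⟨hac, hc⟩ hcy
  refine ⟨hcy, ?_⟩
  exact hS.claw_extend hX hab hay hby hax.symm hbx.symm hyx.symm hac.symm hcy ha hb hy hc

theorem StringClosed.mem_of_graph (hS : StringClosed S) (hX : ∀ a, xs a ∈ S)
    {G : SimpleGraph Q} (hG : G.Connected) (hbip : ¬ G.IsBipartite) (hcyc : ¬ IsCycleGraph G)
    (hZZ : ∀ a b, G.Adj a b → zs a + zs b ∈ S) {u : Q} (hu : zs u ∈ S)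
    {s : PauliString Q} (hs : s ≠ 0) : s ∈ S := by
  have hle : G ≤ zzGraph S := fun a b h => ⟨h.ne, hZZ a b h⟩
  obtain ⟨x, a, b, y, ha, hb, hy, hab, hay, hby⟩ := exists_claw hG hbip hcyc
  have hcl := hS.clawClosed hX
  have hHc := hG.mono hle
  obtain ⟨p, q, r, hpq, hpr, hqr⟩ := hcl.exists_triangle hHc (fun h => hbip (h.mono_left hle))
    (hle ha) (hle hb) (hle hy) hab hay hby
  have hadj : ∀ a b, a ≠ b → zs a + zs b ∈ S := fun v w hvw =>
    (hcl.adj_of_ne hHc hpq hpr hqr hvw).2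
  refine hS.mem_of_ne_zero hX (fun w => ?_) hadj hs
  rcases eq_or_ne w u with rfl | hw
  · exact hu
  obtain ⟨t, -, htw, htu⟩ := exists_ne_ne_of_three hpq.ne hpr.ne hqr.ne w u
  exact hS.zs_mem_of_triangle hX hw htu htw.symm hu (hadj _ _ hw.symm) (hadj _ _ htu.symm)
    (hadj _ _ htw.symm)

end Strings

/-! ### Pauli operators indexed by strings -/

/-- The sign `(-1) ^ c`. -/
noncomputable def sgn (c : ZMod 2) : ℂ := (-1) ^ c.val

lemma sgn_zero : sgn 0 = 1 := by simp [sgn]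

lemma sgn_one : sgn 1 = -1 := by simp [sgn, ZMod.val_one]

lemma sgn_eq (c : ZMod 2) : sgn c = 1 ∨ sgn c = -1 := by
  fin_cases c
  exacts [Or.inl sgn_zero, Or.inr sgn_one]

lemma sgn_add (c d : ZMod 2) : sgn (c + d) = sgn c * sgn d := by
  have h : (1 + 1 : ZMod 2) = 0 := by decide
  have key : ∀ c : ZMod 2, c = 0 ∨ c = 1 := by decide
  rcases key c with rfl | rfl <;> rcases key d with rfl | rfl <;> simp [sgn_zero, sgn_one, h]

lemma sgn_sum {ι : Type*} (T : Finset ι) (f : ι → ZMod 2) :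
    sgn (∑ i ∈ T, f i) = ∏ i ∈ T, sgn (f i) := by
  classical
  induction T using Finset.induction_on with
  | empty => simp [sgn_zero]
  | insert a T ha ih => rw [Finset.sum_insert ha, Finset.prod_insert ha, sgn_add, ih]

/-- The `2 × 2` matrix `X ^ x * Z ^ z`. -/
noncomputable def pauliLetter (p : ZMod 2 × ZMod 2) : Matrix (Fin 2) (Fin 2) ℂ :=
  !![0, 1; 1, 0] ^ p.1.val * !![1, 0; 0, -1] ^ p.2.val

lemma pauliLetter_zero : pauliLetter 0 = 1 := by simp [pauliLetter]

lemma pauliLetter_x : pauliLetter (1, 0) = !![0, 1; 1, 0] := by simp [pauliLetter, ZMod.val_one]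

lemma pauliLetter_z : pauliLetter (0, 1) = !![1, 0; 0, -1] := by simp [pauliLetter, ZMod.val_one]

lemma pauliLetter_mul (p r : ZMod 2 × ZMod 2) :
    pauliLetter p * pauliLetter r = sgn (p.2 * r.1) • pauliLetter (p + r) := by
  have h : (1 + 1 : ZMod 2) = 0 := by decide
  have key : ∀ c : ZMod 2, c = 0 ∨ c = 1 := by decide
  obtain ⟨x, z⟩ := p
  obtain ⟨x', z'⟩ := r
  rcases key x with rfl | rfl <;> rcases key z with rfl | rfl <;>
  rcases key x' with rfl | rfl <;> rcases key z' with rfl | rfl <;>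
  ext i j <;> fin_cases i <;> fin_cases j <;>
  simp [pauliLetter, sgn_zero, sgn_one, h, ZMod.val_one, Matrix.mul_apply, Matrix.one_apply]

lemma exists_eq_sum_pauliLetter (A : Matrix (Fin 2) (Fin 2) ℂ) :
    ∃ f : ZMod 2 × ZMod 2 → ℂ, A = ∑ p, f p • pauliLetter p := by
  -- Coefficients of 1, X, Z and XZ; the last sign comes from XZ = `!![0, -1; 1, 0]`.
  refine ⟨fun p => if p = (0, 0) then (A 0 0 + A 1 1) / 2 else
    if p = (1, 0) then (A 0 1 + A 1 0) / 2 else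
    if p = (0, 1) then (A 0 0 - A 1 1) / 2 else (A 1 0 - A 0 1) / 2, ?_⟩
  have hu : (Finset.univ : Finset (ZMod 2 × ZMod 2)) = {(0, 0), (1, 0), (0, 1), (1, 1)} := by decide
  rw [hu, Finset.sum_insert (by decide), Finset.sum_insert (by decide),
    Finset.sum_insert (by decide), Finset.sum_singleton]
  ext i j
  fin_cases i <;> fin_cases j <;>
  simp [pauliLetter, ZMod.val_one] <;> ring

/-! ### Tensor products of matrices -/

section Tensor

variable {Q : Type*} [Fintype Q]

lemma tensorMatrix_mul [DecidableEq Q] (A B : Q → Matrix (Fin 2) (Fin 2) ℂ) :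
    tensorMatrix A * tensorMatrix B = tensorMatrix fun q => A q * B q := by
  ext x y
  simp only [tensorMatrix, Matrix.mul_apply, Matrix.of_apply, ← Finset.prod_mul_distrib]
  rw [Finset.prod_univ_sum, Fintype.piFinset_univ]

lemma tensorMatrix_smul (c : Q → ℂ) (A : Q → Matrix (Fin 2) (Fin 2) ℂ) :
    (tensorMatrix fun q => c q • A q) = (∏ q, c q) • tensorMatrix A := by
  ext x y
  simp [tensorMatrix, Finset.prod_mul_distrib]

lemma tensorMatrix_one : (tensorMatrix fun _ : Q => 1) = 1 := by
  ext x y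
  simp only [tensorMatrix, Matrix.of_apply, Matrix.one_apply, Finset.prod_ite_zero]
  simp [funext_iff]

lemma tensorMatrix_conjTranspose (A : Q → Matrix (Fin 2) (Fin 2) ℂ) :
    (tensorMatrix A)ᴴ = tensorMatrix fun q => (A q)ᴴ := by
  ext x y
  simp [tensorMatrix, Matrix.conjTranspose_apply]

lemma tensorMatrix_sum [DecidableEq Q] {ι : Type*} [Fintype ι]
    (A : Q → ι → Matrix (Fin 2) (Fin 2) ℂ) :
    (tensorMatrix fun q => ∑ i, A q i) = ∑ s : Q → ι, tensorMatrix fun q => A q (s q) := by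
  ext x y
  simp only [tensorMatrix, Matrix.of_apply, Matrix.sum_apply]
  rw [Finset.prod_univ_sum, Fintype.piFinset_univ]

lemma tensorMatrix_single (x y : Q → Fin 2) [DecidableEq Q] :
    (tensorMatrix fun q => Matrix.single (x q) (y q) 1) = Matrix.single x y 1 := by
  ext x' y'
  simp only [tensorMatrix, Matrix.of_apply, Matrix.single_apply, Finset.prod_ite_zero]
  simp [funext_iff, forall_and]

/-- The sign in `pauliOp s * pauliOp t = ± pauliOp (s + t)`. -/
def pauliCocycle (s t : PauliString Q) : ZMod 2 := ∑ q, (s q).2 * (t q).1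

lemma sform_eq_pauliCocycle (s t : PauliString Q) :
    sform s t = pauliCocycle s t + pauliCocycle t s := by
  simp only [sform, pauliCocycle, ← Finset.sum_add_distrib]
  exact Finset.sum_congr rfl fun q _ => by ring

end Tensor

section PauliOp

variable {Q : Type*} [Fintype Q] [DecidableEq Q]

/-- The operator `⨂_q X ^ x_q * Z ^ z_q` of a Pauli string. -/
noncomputable def pauliOp (s : PauliString Q) : Module.End ℂ (StateSpace Q) :=
  Matrix.toEuclideanLin (tensorMatrix fun q => pauliLetter (s q))

lemma onQubit_pauliLetter (q : Q) (p : ZMod 2 × ZMod 2) :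
    onQubit q (pauliLetter p) = pauliOp (Pi.single q p) := by
  rw [onQubit, pauliOp]
  congr 2
  ext1 q'
  rcases eq_or_ne q' q with rfl | h
  · simp
  · simp [h, pauliLetter_zero]

lemma pauliX_eq (q : Q) : pauliX q = pauliOp (xs q) := by
  rw [pauliX, ← pauliLetter_x, onQubit_pauliLetter, xs]

lemma pauliZ_eq (q : Q) : pauliZ q = pauliOp (zs q) := by
  rw [pauliZ, ← pauliLetter_z, onQubit_pauliLetter, zs]

lemma pauliOp_zero : pauliOp (0 : PauliString Q) = 1 := by
  simp only [pauliOp, Pi.zero_apply, pauliLetter_zero, tensorMatrix_one]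
  exact Matrix.toLpLin_one 2

lemma pauliOp_mul (s t : PauliString Q) :
    pauliOp s * pauliOp t = sgn (pauliCocycle s t) • pauliOp (s + t) := by
  have h := Matrix.toLpLin_mul_same 2 (tensorMatrix fun q => pauliLetter (s q))
    (tensorMatrix fun q => pauliLetter (t q))
  rw [tensorMatrix_mul] at h
  simp only [pauliLetter_mul] at h
  rw [tensorMatrix_smul, map_smul] at h
  rw [pauliCocycle, sgn_sum]
  exact h.symm

lemma pauliOp_mul_comm (s t : PauliString Q) :
    pauliOp s * pauliOp t = sgn (sform s t) • (pauliOp t * pauliOp s) := by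
  rw [pauliOp_mul, pauliOp_mul, sform_eq_pauliCocycle, sgn_add, smul_smul, mul_assoc, ← sgn_add,
    CharTwo.add_self_eq_zero, sgn_zero, mul_one, add_comm t]

lemma pauliOp_mul_self (s : PauliString Q) :
    pauliOp s * pauliOp s = sgn (pauliCocycle s s) • 1 := by
  rw [pauliOp_mul, ← pauliOp_zero]
  congr 2
  ext q <;> exact CharTwo.add_self_eq_zero _

/-- Conjugation by an anticommuting Pauli operator preserves the trace and reverses the sign. -/
lemma trace_pauliOp {s : PauliString Q} (hs : s ≠ 0) :
    LinearMap.trace ℂ (StateSpace Q) (pauliOp s) = 0 := by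
  obtain ⟨t, ht⟩ := exists_sform_eq_one hs
  have h1 := pauliOp_mul_comm s t
  rw [ht, sgn_one] at h1
  have h2 : LinearMap.trace ℂ (StateSpace Q) (pauliOp t * pauliOp s * pauliOp t) =
      LinearMap.trace ℂ (StateSpace Q) (pauliOp t * (pauliOp t * pauliOp s)) :=
    LinearMap.trace_mul_comm _ _ _
  rw [mul_assoc, h1, mul_smul_comm, ← mul_assoc, pauliOp_mul_self, smul_mul_assoc, one_mul,
    map_smul, map_smul] at h2
  rcases sgn_eq (pauliCocycle t t) with h | h <;> rw [h] at h2 <;> simp at h2 <;>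
  simpa [CharZero.neg_eq_self_iff, CharZero.eq_neg_self_iff] using h2

/-- A matrix unit is a tensor product of 2 × 2 matrix units; expand each factor in Pauli letters. -/
lemma exists_eq_sum_pauliOp (A : Module.End ℂ (StateSpace Q)) :
    ∃ f : PauliString Q → ℂ, A = ∑ s, f s • pauliOp s := by
  have key : ∀ M : Matrix (Q → Fin 2) (Q → Fin 2) ℂ,
      Matrix.toEuclideanLin M ∈ Submodule.span ℂ (Set.range (pauliOp (Q := Q))) := by
    intro M
    rw [Matrix.matrix_eq_sum_single M, map_sum]
    refine Submodule.sum_mem _ fun x _ => ?_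
    rw [map_sum]
    refine Submodule.sum_mem _ fun y _ => ?_
    rw [← mul_one (M x y), ← smul_eq_mul, ← Matrix.smul_single, map_smul]
    refine Submodule.smul_mem _ _ ?_
    rw [← tensorMatrix_single]
    choose f hf using fun q => exists_eq_sum_pauliLetter (Matrix.single (x q) (y q) 1)
    rw [funext hf, tensorMatrix_sum, map_sum]
    refine Submodule.sum_mem _ fun s _ => ?_
    rw [tensorMatrix_smul, map_smul]
    exact Submodule.smul_mem _ _ (Submodule.subset_span ⟨s, rfl⟩)
  obtain ⟨f, hf⟩ := (Submodule.mem_span_range_iff_exists_fun ℂ).1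
    (key (Matrix.toEuclideanLin.symm A))
  exact ⟨f, by rw [hf, LinearEquiv.apply_symm_apply]⟩

lemma adjoint_onQubit (q : Q) {A : Matrix (Fin 2) (Fin 2) ℂ} (hA : Aᴴ = A) :
    LinearMap.adjoint (onQubit q A) = onQubit q A := by
  rw [onQubit, ← Matrix.toEuclideanLin_conjTranspose_eq_adjoint, tensorMatrix_conjTranspose]
  congr 2
  ext1 q'
  rcases eq_or_ne q' q with rfl | h
  · simp [hA]
  · simp [h]

lemma adjoint_pauliX (q : Q) : LinearMap.adjoint (pauliX q) = pauliX q :=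
  adjoint_onQubit q <| by ext i j; fin_cases i <;> fin_cases j <;> simp

lemma adjoint_pauliZ (q : Q) : LinearMap.adjoint (pauliZ q) = pauliZ q :=
  adjoint_onQubit q <| by ext i j; fin_cases i <;> fin_cases j <;> simp

/-- The strings whose operators, up to a factor `1` or `i`, belong to a Lie algebra. -/
def stringSupport (g : LieSubalgebra ℝ (Module.End ℂ (StateSpace Q))) : Set (PauliString Q) :=
  {s | ∃ c : ℂ, (c = 1 ∨ c = Complex.I) ∧ c • pauliOp s ∈ g}

/-- The bracket is ±2cd times the operator of s + t, and a real factor ±1/2 brings this coefficient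
back to 1 or i. -/
lemma stringClosed_stringSupport (g : LieSubalgebra ℝ (Module.End ℂ (StateSpace Q))) :
    StringClosed (stringSupport g) := by
  rintro s ⟨c, hc, hs⟩ t ⟨d, hd, ht⟩ hst
  have h := g.lie_mem hs ht
  have h1 := pauliOp_mul_comm t s
  rw [sform_comm, hst, sgn_one] at h1
  have h2 : ⁅c • pauliOp s, d • pauliOp t⁆ =
      (2 * (c * d) * sgn (pauliCocycle s t)) • pauliOp (s + t) := by
    rw [LieRing.of_associative_ring_bracket, smul_mul_smul_comm, smul_mul_smul_comm, h1,
      pauliOp_mul, smul_smul, smul_smul, smul_smul, ← sub_smul]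
    congr 1; ring
  rw [h2] at h
  have h3 : ∃ r : ℝ, ∃ e : ℂ, (e = 1 ∨ e = Complex.I) ∧
      (r : ℂ) * (2 * (c * d) * sgn (pauliCocycle s t)) = e := by
    rcases sgn_eq (pauliCocycle s t) with h | h <;> rw [h] <;>
    rcases hc with rfl | rfl <;> rcases hd with rfl | rfl
    · exact ⟨1 / 2, 1, by simp, by simp⟩
    · exact ⟨1 / 2, Complex.I, by simp, by simp⟩
    · exact ⟨1 / 2, Complex.I, by simp, by simp⟩
    · exact ⟨-1 / 2, 1, by simp, by simp⟩
    · exact ⟨-1 / 2, 1, by simp, by simp⟩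
    · exact ⟨-1 / 2, Complex.I, by simp, by simp; ring⟩
    · exact ⟨-1 / 2, Complex.I, by simp, by simp; ring⟩
    · exact ⟨1 / 2, 1, by simp, by simp⟩
  obtain ⟨r, e, he, hre⟩ := h3
  refine ⟨e, he, ?_⟩
  have h4 := g.smul_mem r h
  rwa [← Complex.coe_smul, smul_smul, hre] at h4

end PauliOp

/-! ### Real bases of Pauli operators and simplicity of `su` -/

section Basis

variable {Q : Type*} [Fintype Q] [DecidableEq Q]

/-- A family of multiples of the Pauli operators by `1` or `i` whose nontrivial members are
traceless and skew-Hermitian. -/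
structure IsSkewPauliBasis (B : PauliString Q → Module.End ℂ (StateSpace Q)) : Prop where
  exists_eq_smul : ∀ s, ∃ c : ℂ, (c = 1 ∨ c = Complex.I) ∧ B s = c • pauliOp s
  mem : ∀ s, s ≠ 0 → B s ∈ specialUnitary (StateSpace Q)

namespace IsSkewPauliBasis

variable {B : PauliString Q → Module.End ℂ (StateSpace Q)}

lemma mul_comm_of_sform_eq_one (hB : IsSkewPauliBasis B) {s t : PauliString Q}
    (h : sform s t = 1) : B s * B t = -(B t * B s) := by
  obtain ⟨c, -, hc⟩ := hB.exists_eq_smul s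
  obtain ⟨d, -, hd⟩ := hB.exists_eq_smul t
  rw [hc, hd, smul_mul_smul_comm, smul_mul_smul_comm, pauliOp_mul_comm s t, h, sgn_one, mul_comm d]
  simp

lemma mul_comm_of_sform_eq_zero (hB : IsSkewPauliBasis B) {s t : PauliString Q}
    (h : sform s t = 0) : B s * B t = B t * B s := by
  obtain ⟨c, -, hc⟩ := hB.exists_eq_smul s
  obtain ⟨d, -, hd⟩ := hB.exists_eq_smul t
  rw [hc, hd, smul_mul_smul_comm, smul_mul_smul_comm, pauliOp_mul_comm s t, h, sgn_zero, mul_comm d]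
  simp

lemma exists_mul_self (hB : IsSkewPauliBasis B) (s : PauliString Q) :
    ∃ k : ℝ, k ≠ 0 ∧ B s * B s = k • (1 : Module.End ℂ (StateSpace Q)) := by
  obtain ⟨c, hc, h⟩ := hB.exists_eq_smul s
  have h1 : B s * B s = (c * c * sgn (pauliCocycle s s)) • (1 : Module.End ℂ (StateSpace Q)) := by
    rw [h, smul_mul_smul_comm, pauliOp_mul_self, smul_smul]
  rcases hc with rfl | rfl <;> rcases sgn_eq (pauliCocycle s s) with h2 | h2 <;> rw [h2] at h1
  · exact ⟨1, by simp, by simpa using h1⟩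
  · exact ⟨-1, by simp, by simpa using h1⟩
  · exact ⟨-1, by simp, by simpa using h1⟩
  · exact ⟨1, by simp, by simpa using h1⟩

/-- The trace kills the coefficient at 0. After subtracting the part with real coefficients, what
remains is both Hermitian and skew-Hermitian, hence zero. -/
lemma exists_eq_sum (hB : IsSkewPauliBasis B) {A : Module.End ℂ (StateSpace Q)}
    (hA : A ∈ specialUnitary (StateSpace Q)) :
    ∃ a : PauliString Q → ℝ, a 0 = 0 ∧ A = ∑ s, a s • B s := by
  obtain ⟨f, hf⟩ := exists_eq_sum_pauliOp A
  have hf0 : f 0 = 0 := by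
    have h := hA.2
    rw [hf, map_sum, Finset.sum_eq_single 0 (fun s _ hs => by rw [map_smul, trace_pauliOp hs,
      smul_zero]) (by simp), map_smul, pauliOp_zero, LinearMap.trace_one] at h
    simpa using h
  choose c hc hBc using hB.exists_eq_smul
  have hc0 : ∀ s, c s ≠ 0 := fun s => by rcases hc s with h | h <;> simp [h]
  set d : PauliString Q → ℂ := fun s => f s / c s with hd
  have hd0 : d 0 = 0 := by simp [hd, hf0]
  have hAd : A = ∑ s, d s • B s := by
    rw [hf]
    refine Finset.sum_congr rfl fun s _ => ?_
    rw [hBc, smul_smul, hd, div_mul_cancel₀ _ (hc0 s)]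
  have hmem : ∀ e : PauliString Q → ℝ, e 0 = 0 →
      ∑ s, e s • B s ∈ specialUnitary (StateSpace Q) := fun e he => by
    refine sum_mem fun s _ => ?_
    rcases eq_or_ne s 0 with rfl | hs
    · rw [he, zero_smul]; exact zero_mem _
    · exact (specialUnitary (StateSpace Q)).smul_mem _ (hB.mem s hs)
  refine ⟨fun s => (d s).re, by simp [hd0], ?_⟩
  set C := ∑ s, (d s).im • B s
  have hC : C ∈ specialUnitary (StateSpace Q) := hmem _ (by simp [hd0])
  have hsub : A - ∑ s, (d s).re • B s = Complex.I • C := by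
    rw [hAd, Finset.smul_sum, ← Finset.sum_sub_distrib]
    refine Finset.sum_congr rfl fun s _ => ?_
    rw [← Complex.coe_smul, ← Complex.coe_smul, smul_smul, ← sub_smul]
    congr 1
    rw [sub_eq_iff_eq_add, add_comm, mul_comm, Complex.re_add_im]
  have h1 := (sub_mem hA (hmem (fun s => (d s).re) (by simp [hd0]))).1
  have h2 : LinearMap.adjoint (Complex.I • C) = Complex.I • C := by
    rw [map_smulₛₗ, hC.1]; simp
  rw [hsub, h2] at h1
  have h3 : (2 : ℂ) • Complex.I • C = 0 := by
    rw [two_smul]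
    nth_rewrite 1 [h1]
    exact neg_add_cancel _
  rw [(smul_eq_zero.1 h3).resolve_left two_ne_zero, sub_eq_zero] at hsub
  exact hsub

/-- Here k is four times the scalar B_p²; since k does not depend on t, the square of ad B_p acts as
a multiple of a projection. -/
lemma lie_lie_of_sform_eq_one (hB : IsSkewPauliBasis B) {p : PauliString Q} :
    ∃ k : ℝ, k ≠ 0 ∧ ∀ t, ⁅B p, ⁅B p, B t⁆⁆ = if sform p t = 1 then k • B t else 0 := by
  obtain ⟨k, hk, h⟩ := hB.exists_mul_self p
  refine ⟨4 * k, by simpa using hk, fun t => ?_⟩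
  have key : ∀ c : ZMod 2, c = 0 ∨ c = 1 := by decide
  rcases key (sform p t) with h0 | h1
  · rw [if_neg (by rw [h0]; decide), LieRing.of_associative_ring_bracket (B p) (B t),
      hB.mul_comm_of_sform_eq_zero h0, sub_self, lie_zero]
  · have e := hB.mul_comm_of_sform_eq_one h1
    have e' : B t * B p = -(B p * B t) := by rw [e, neg_neg]
    rw [if_pos h1, LieRing.of_associative_ring_bracket, LieRing.of_associative_ring_bracket, e',
      sub_neg_eq_add, mul_add, add_mul, mul_assoc, e', mul_neg, ← mul_assoc, h, smul_mul_assoc,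
      one_mul]
    module

variable {J : Submodule ℝ (Module.End ℂ (StateSpace Q))}

/-- Descent on the number of terms: if two strings occur, some p anticommutes with exactly one of
them, and the projection attached to p drops one and keeps the other. -/
lemma exists_mem_of_sum_mem (hB : IsSkewPauliBasis B)
    (hJ : ∀ A ∈ J, ∀ s, s ≠ 0 → ⁅B s, A⁆ ∈ J) (n : ℕ) :
    ∀ a : PauliString Q → ℝ, a 0 = 0 → a ≠ 0 → (Finset.univ.filter fun s => a s ≠ 0).card = n →
      ∑ s, a s • B s ∈ J → ∃ s, s ≠ 0 ∧ B s ∈ J := by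
  induction n using Nat.strong_induction_on with
  | _ n ih =>
    intro a ha0 ha hn hmem
    obtain ⟨s, hs⟩ := Function.ne_iff.1 ha
    have hs0 : s ≠ 0 := by rintro rfl; exact hs ha0
    by_cases hex : ∃ t, t ≠ s ∧ a t ≠ 0
    · obtain ⟨t, hts, hat⟩ := hex
      have hst : s + t ≠ 0 := fun h => hts (by
        rw [add_eq_zero_iff_neg_eq, ZModModule.neg_eq_self] at h; exact h.symm)
      obtain ⟨p, hp⟩ := exists_sform_eq_one hst
      have hp0 : p ≠ 0 := by rintro rfl; simp [sform] at hp
      rw [sform_comm, sform_add_right] at hp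
      obtain ⟨k, hk, hl⟩ := hB.lie_lie_of_sform_eq_one (p := p)
      let a' : PauliString Q → ℝ := fun r => if sform p r = 1 then a r else 0
      have ha' : ∑ r, a' r • B r ∈ J := by
        have h1 := J.smul_mem k⁻¹ (hJ _ (hJ _ hmem p hp0) p hp0)
        convert h1 using 1
        rw [lie_sum, lie_sum, Finset.smul_sum]
        refine Finset.sum_congr rfl fun r _ => ?_
        rw [lie_smul, lie_smul, hl]
        by_cases hr : sform p r = 1
        · simp only [a', hr, if_true]
          rw [smul_comm, smul_smul k⁻¹, inv_mul_cancel₀ hk, one_smul]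
        · simp [a', hr]
      have key : ∀ c d : ZMod 2, c + d = 1 → (c = 1 ∧ d ≠ 1) ∨ (c ≠ 1 ∧ d = 1) := by decide
      obtain ⟨u, w, hu, haw, hpu, hpw⟩ : ∃ u w, a u ≠ 0 ∧ a w ≠ 0 ∧ sform p u = 1 ∧
          sform p w ≠ 1 := by
        rcases key _ _ hp with h | h
        exacts [⟨s, t, hs, hat, h.1, h.2⟩, ⟨t, s, hat, hs, h.2, h.1⟩]
      refine ih _ ?_ a' (by simp [a', ha0]) (fun h => hu (by simpa [a', hpu] using congrFun h u))
        rfl ha'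
      rw [← hn]
      refine Finset.card_lt_card ⟨fun r => ?_, fun h => ?_⟩
      · simp only [Finset.mem_filter, Finset.mem_univ, true_and, a']
        intro h h'
        simp [h'] at h
      · have := h (show w ∈ Finset.univ.filter fun s => a s ≠ 0 by simpa using haw)
        simp [a', hpw] at this
    · push Not at hex
      refine ⟨s, hs0, ?_⟩
      rw [Finset.sum_eq_single s (fun t _ ht => by rw [hex t ht, zero_smul]) (by simp)] at hmem
      have := J.smul_mem (a s)⁻¹ hmem
      rwa [smul_smul, inv_mul_cancel₀ hs, one_smul] at this

/-- For anticommuting s and r, applying ad B_s twice to B_r returns a nonzero multiple of B_r;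
arbitrary s and t are linked through a common anticommuting string. -/
lemma mem_of_mem (hB : IsSkewPauliBasis B) (hJ : ∀ A ∈ J, ∀ s, s ≠ 0 → ⁅B s, A⁆ ∈ J)
    {s t : PauliString Q} (hs : s ≠ 0) (ht : t ≠ 0) (h : B s ∈ J) : B t ∈ J := by
  have step : ∀ s r : PauliString Q, s ≠ 0 → r ≠ 0 → sform s r = 1 → B s ∈ J → B r ∈ J := by
    intro s r hs hr hsr h
    obtain ⟨k, hk, hl⟩ := hB.lie_lie_of_sform_eq_one (p := s)
    have h1 : ⁅B s, B r⁆ ∈ J := by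
      rw [← lie_skew]; exact J.neg_mem (hJ _ h r hr)
    have h2 := J.smul_mem k⁻¹ (hJ _ h1 s hs)
    rwa [hl, if_pos hsr, smul_smul, inv_mul_cancel₀ hk, one_smul] at h2
  obtain ⟨r, hsr, htr⟩ := exists_sform_eq_one_and hs ht
  have hr : r ≠ 0 := by rintro rfl; simp [sform] at hsr
  exact step r t hr ht (by rw [sform_comm, htr]) (step s r hs hr hsr h)

theorem isSimple (hB : IsSkewPauliBasis B) [Nonempty Q] :
    LieAlgebra.IsSimple ℝ (specialUnitary (StateSpace Q)) where
  eq_bot_or_eq_top I := by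
    rw [or_iff_not_imp_left]
    intro hI
    let J : Submodule ℝ (Module.End ℂ (StateSpace Q)) :=
      (I : Submodule ℝ (specialUnitary (StateSpace Q))).map
        (specialUnitary (StateSpace Q)).toSubmodule.subtype
    have hJ : ∀ A ∈ J, ∀ s, s ≠ 0 → ⁅B s, A⁆ ∈ J := by
      rintro _ ⟨A, hA, rfl⟩ s hs
      exact ⟨⁅(⟨B s, hB.mem s hs⟩ : specialUnitary (StateSpace Q)), A⁆,
        I.lie_mem hA, rfl⟩
    obtain ⟨A, hA, hA0⟩ : ∃ A ∈ I, A ≠ 0 := by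
      by_contra h
      exact hI ((LieSubmodule.eq_bot_iff I).2 fun A hA => by_contra fun h0 => h ⟨A, hA, h0⟩)
    obtain ⟨a, ha0, ha⟩ := hB.exists_eq_sum A.2
    have hane : a ≠ 0 := by
      rintro rfl
      exact hA0 (Subtype.ext (by rw [ha]; simp))
    obtain ⟨s, hs, hsJ⟩ := hB.exists_mem_of_sum_mem hJ _ a ha0 hane rfl (ha ▸ ⟨A, hA, rfl⟩)
    refine LieSubmodule.ext _ _ fun A' => ⟨fun _ => LieSubmodule.mem_top _, fun _ => ?_⟩
    obtain ⟨a, ha0, ha⟩ := hB.exists_eq_sum A'.2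
    have h : (A' : Module.End ℂ (StateSpace Q)) ∈ J := by
      rw [ha]
      refine sum_mem fun t _ => ?_
      rcases eq_or_ne t 0 with rfl | ht
      · rw [ha0, zero_smul]; exact zero_mem _
      · exact J.smul_mem _ (hB.mem_of_mem hJ hs ht hsJ)
    obtain ⟨A'', hA'', h⟩ := h
    rwa [← Subtype.ext h]
  non_abelian h := by
    obtain ⟨q⟩ := ‹Nonempty Q›
    have hx : xs q ≠ 0 := by simp [xs]
    have hz : zs q ≠ 0 := by simp [zs]
    have h0 := congrArg (Subtype.val) (h.trivial (⟨B (xs q), hB.mem _ hx⟩ :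
      specialUnitary (StateSpace Q)) ⟨B (zs q), hB.mem _ hz⟩)
    replace h0 : ⁅B (xs q), B (zs q)⁆ = 0 := h0
    obtain ⟨k, hk, hl⟩ := hB.lie_lie_of_sform_eq_one (p := xs q)
    have h1 := hl (zs q)
    rw [h0, lie_zero, if_pos (by simp)] at h1
    have h2 := (smul_eq_zero.1 h1.symm).resolve_left hk
    obtain ⟨k', hk', hl'⟩ := hB.exists_mul_self (zs q)
    rw [h2, mul_zero, eq_comm, smul_eq_zero] at hl'
    exact one_ne_zero (hl'.resolve_left hk')

end IsSkewPauliBasis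

theorem eq_specialUnitary_and_isSimple [Nonempty Q]
    {g : LieSubalgebra ℝ (Module.End ℂ (StateSpace Q))} (hg : g ≤ specialUnitary (StateSpace Q))
    (h : ∀ s, s ≠ 0 → s ∈ stringSupport g) :
    g = specialUnitary (StateSpace Q) ∧ LieAlgebra.IsSimple ℝ (specialUnitary (StateSpace Q)) := by
  have h' : ∀ s, ∃ c : ℂ, (c = 1 ∨ c = Complex.I) ∧ (s ≠ 0 → c • pauliOp s ∈ g) := fun s => by
    rcases eq_or_ne s 0 with rfl | hs
    -- The identity string is not required to lie in g, so its phase is arbitrary.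
    · exact ⟨1, Or.inl rfl, fun h => absurd rfl h⟩
    · obtain ⟨c, hc, hm⟩ := h s hs
      exact ⟨c, hc, fun _ => hm⟩
  choose c hc hm using h'
  have hB : IsSkewPauliBasis fun s => c s • pauliOp s :=
    ⟨fun s => ⟨c s, hc s, rfl⟩, fun s hs => hg (hm s hs)⟩
  refine ⟨le_antisymm hg fun A hA => ?_, hB.isSimple⟩
  obtain ⟨a, ha0, ha⟩ := hB.exists_eq_sum hA
  rw [ha]
  refine sum_mem fun t _ => ?_
  rcases eq_or_ne t 0 with rfl | ht
  · rw [ha0, zero_smul]; exact zero_mem _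
  · exact g.smul_mem _ (hm t ht)

end Basis

/-! ### Operators and matrices -/

/-- `su(W)` on a space of `k` qubits is the matrix Lie algebra `su(2 ^ k)`. -/
theorem nonempty_specialUnitary_equiv_su {Q : Type*} [Fintype Q] [DecidableEq Q] {N : ℕ}
    (hN : Fintype.card (Q → Fin 2) = N) :
    Nonempty (specialUnitary (StateSpace Q) ≃ₗ⁅ℝ⁆ su N) := by
  let e : (Q → Fin 2) ≃ Fin N := Fintype.equivFinOfCardEq hN
  let φ : Module.End ℂ (StateSpace Q) ≃ₐ[ℂ] Matrix (Fin N) (Fin N) ℂ :=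
    (Matrix.toLpLinAlgEquiv 2).symm.trans (Matrix.reindexAlgEquiv ℂ ℂ e)
  have hφ : ∀ M : Matrix (Q → Fin 2) (Q → Fin 2) ℂ,
      φ (Matrix.toEuclideanLin M) = M.submatrix e.symm e.symm := fun M => by
    change Matrix.reindexAlgEquiv ℂ ℂ e ((Matrix.toLpLinAlgEquiv 2).symm
      (Matrix.toLpLinAlgEquiv 2 M)) = _
    rw [AlgEquiv.symm_apply_apply]
    rfl
  let ψ : Module.End ℂ (StateSpace Q) ≃ₗ⁅ℝ⁆ Matrix (Fin N) (Fin N) ℂ :=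
    { (φ.toLinearEquiv.restrictScalars ℝ) with
      map_lie' := fun {A B} => by
        change φ ⁅A, B⁆ = ⁅φ A, φ B⁆
        simp only [LieRing.of_associative_ring_bracket, map_sub, map_mul] }
  refine ⟨LieEquiv.ofSubalgebras _ _ ψ ?_⟩
  have hmem : ∀ M : Matrix (Q → Fin 2) (Q → Fin 2) ℂ,
      Matrix.toEuclideanLin M ∈ specialUnitary (StateSpace Q) ↔
        φ (Matrix.toEuclideanLin M) ∈ su N := fun M => by
    rw [hφ]
    change (_ = _ ∧ _ = _) ↔ (_ = _ ∧ _ = _)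
    rw [← Matrix.toEuclideanLin_conjTranspose_eq_adjoint, ← map_neg,
      Matrix.toEuclideanLin.injective.eq_iff, Matrix.conjTranspose_submatrix]
    have htr : LinearMap.trace ℂ (StateSpace Q) (Matrix.toEuclideanLin M) =
        (M.submatrix e.symm e.symm).trace := by
      rw [Matrix.toEuclideanLin_eq_toLin_orthonormal,
        LinearMap.trace_eq_matrix_trace ℂ (EuclideanSpace.basisFun (Q → Fin 2) ℂ).toBasis,
        LinearMap.toMatrix_toLin]
      exact (Equiv.sum_comp e.symm fun i => M i i).symm
    rw [htr]
    refine and_congr_left fun _ => ⟨fun h => by rw [h]; rfl, fun h => ?_⟩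
    exact (Matrix.reindex e e).injective h
  ext M'
  obtain ⟨A, rfl⟩ := φ.surjective M'
  obtain ⟨M, rfl⟩ := Matrix.toEuclideanLin.surjective A
  rw [← hmem]
  constructor
  · rintro ⟨A, hA, h⟩
    rwa [← φ.injective h]
  · exact fun h => ⟨_, h, rfl⟩

/-! ### The free reduced dynamical Lie algebra -/

section Generators

lemma zs_add_zs_ne_zero {Q : Type*} [DecidableEq Q] {a b : Q} (hab : a ≠ b) :
    zs a + zs b ≠ 0 := fun h => by
  simpa [zs, hab] using congrArg Prod.snd (congrFun h a)

variable {Q : Type*} [Fintype Q] [DecidableEq Q]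

lemma smul_I_mem_specialUnitary {A : Module.End ℂ (StateSpace Q)} (hA : LinearMap.adjoint A = A)
    (htr : LinearMap.trace ℂ (StateSpace Q) A = 0) :
    Complex.I • A ∈ specialUnitary (StateSpace Q) :=
  ⟨by rw [map_smulₛₗ, hA]; simp, by rw [map_smul, htr, smul_zero]⟩

lemma pauliZ_mul_pauliZ (a b : Q) : pauliZ a * pauliZ b = pauliOp (zs a + zs b) := by
  rw [pauliZ_eq, pauliZ_eq, pauliOp_mul, show pauliCocycle (zs a) (zs b) = 0 from ?_, sgn_zero,
    one_smul]
  refine Finset.sum_eq_zero fun q _ => ?_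
  rcases eq_or_ne q b with rfl | h <;> simp [zs, *]

end Generators

section Reduced

variable {V : Type*} [Fintype V] [DecidableEq V] (Γ : SimpleGraph V) (v : V)

lemma freeReducedDLA_le : freeReducedDLA Γ v ≤ specialUnitary (ReducedSpace v) := by
  refine LieSubalgebra.lieSpan_le.2 ?_
  rintro A ((⟨w, rfl⟩ | ⟨w, w', hww', rfl⟩) | ⟨w, -, rfl⟩)
  · exact smul_I_mem_specialUnitary (adjoint_pauliX w)
      (by rw [pauliX_eq]; exact trace_pauliOp (by simp [xs]))
  · refine smul_I_mem_specialUnitary ?_ ?_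
    · rw [Module.End.mul_eq_comp, LinearMap.adjoint_comp, adjoint_pauliZ, adjoint_pauliZ,
        ← Module.End.mul_eq_comp, ← Module.End.mul_eq_comp, pauliZ_mul_pauliZ, pauliZ_mul_pauliZ,
        add_comm]
    · rw [pauliZ_mul_pauliZ]
      exact trace_pauliOp (zs_add_zs_ne_zero hww'.ne)
  · exact smul_I_mem_specialUnitary (adjoint_pauliZ w)
      (by rw [pauliZ_eq]; exact trace_pauliOp (by simp [zs]))

lemma mem_stringSupport_freeReducedDLA (hΓ : Γ.Connected) (hconn : (reducedGraph Γ v).Connected)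
    (hbip : ¬ (reducedGraph Γ v).IsBipartite) (hcyc : ¬ IsCycleGraph (reducedGraph Γ v))
    {s : PauliString {w : V // w ≠ v}} (hs : s ≠ 0) : s ∈ stringSupport (freeReducedDLA Γ v) := by
  obtain ⟨w₀⟩ := hconn.nonempty
  have : Nontrivial V := ⟨w₀, v, w₀.2⟩
  -- Connectedness of Γ supplies a neighbour of v, hence the generator i Z_u.
  obtain ⟨u, hu⟩ := hΓ.preconnected.exists_adj_of_nontrivial v
  refine (stringClosed_stringSupport _).mem_of_graph (fun a => ?_) hconn hbip hcyc
    (fun a b hab => ?_) (u := ⟨u, hu.ne'⟩) ?_ hs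
  · exact ⟨Complex.I, Or.inr rfl, by
      rw [← pauliX_eq]; exact LieSubalgebra.subset_lieSpan (Or.inl (Or.inl ⟨a, rfl⟩))⟩
  · exact ⟨Complex.I, Or.inr rfl, by
      rw [← pauliZ_mul_pauliZ]
      exact LieSubalgebra.subset_lieSpan (Or.inl (Or.inr ⟨a, b, hab, rfl⟩))⟩
  · exact ⟨Complex.I, Or.inr rfl, by
      rw [← pauliZ_eq]; exact LieSubalgebra.subset_lieSpan (Or.inr ⟨_, hu, rfl⟩)⟩

end Reduced

end QAOA

theorem mainTheorem3 {V : Type*} [Fintype V] [DecidableEq V] (Γ : SimpleGraph V)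
    (hΓ : Γ.Connected) (v : V) (hconn : (QAOA.reducedGraph Γ v).Connected)
    (hbip : ¬ (QAOA.reducedGraph Γ v).IsBipartite)
    (hcyc : ¬ QAOA.IsCycleGraph (QAOA.reducedGraph Γ v)) :
    LieAlgebra.IsSimple ℝ (QAOA.freeReducedDLA Γ v) ∧
      QAOA.freeReducedDLA Γ v = QAOA.specialUnitary (QAOA.ReducedSpace v) ∧
      Nonempty (QAOA.specialUnitary (QAOA.ReducedSpace v) ≃ₗ⁅ℝ⁆
        QAOA.su (2 ^ (Fintype.card V - 1))) := by
  have := hconn.nonempty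
  obtain ⟨h, hsimple⟩ := QAOA.eq_specialUnitary_and_isSimple (QAOA.freeReducedDLA_le Γ v)
    fun s hs => QAOA.mem_stringSupport_freeReducedDLA Γ v hΓ hconn hbip hcyc hs
  refine ⟨h ▸ hsimple, h, QAOA.nonempty_specialUnitary_equiv_su ?_⟩
  rw [Fintype.card_fun, Fintype.card_fin, Fintype.card_subtype_compl, Fintype.card_subtype_eq]
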